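/- Let $J:\mathbb{N}^{\mathbb{N}}\to\mathbb{N}^{\mathbb{N}}$ be the Turing jump operator, $J(p)(n)=1$ if $p\in U_n$ and $J(p)(n)=0$ otherwise, where $(U_n)_{n\in\mathbb{N}}$ is the standard enumeration of the c.e. open subsets of Baire space $\mathbb{N}^{\mathbb{N}}$. Let $\lim\langle p_0,p_1,\dots\rangle=\lim_{i\to\infty}p_i$ be the partial limit map on Baire space with its usual topology, let $\mathsf{L}=J^{-1}\circ\lim$, and let $\lim_J\langle p_0,p_1,\dots\rangle$ be the limit of $(p_i)_{i\in\mathbb{N}}$ with respect to the initial topology of $J$, that is, the coarsest topology on the domain of $J$ that makes $J$ continuous into Baire space. Both $\mathsf{L}$ and $\lim_J$ are partial maps on Baire space, which is represented by the identity. Let $\mathsf{C}_{\{0,1\}^{\mathbb{N}}}$ be closed choice on Cantor space: given a nonempty closed set $A\subseteq\{0,1\}^{\mathbb{N}}$ through an enumeration of words $w_i$ with $A=\{0,1\}^{\mathbb{N}}\setminus\bigcup_i w_i\{0,1\}^{\mathbb{N}}$, find a point of $A$. Let $\leq_{\mathrm W}$ and $\leq_{\mathrm{sW}}$ denote Weihrauch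 and strong Weihrauch reducibility. Then: 1. $\lim_J<_{\mathrm{sW}}\mathsf{L}$, that is, $\lim_J\leq_{\mathrm{sW}}\mathsf{L}$ and $\mathsf{L}\not\leq_{\mathrm{sW}}\lim_J$. 2. $\mathsf{C}_{\{0,1\}^{\mathbb{N}}}\not\leq_{\mathrm W}\lim_J$. 3. If $f:\mathbb{N}\to\mathbb{N}$ is diagonally non-computable (that is, $f(i)\neq\varphi_i(i)$ whenever $\varphi_i(i)$ is defined, where $\varphi$ is the standard Gödel numbering of the partial computable functions) and $p\in\mathbb{N}^{\mathbb{N}}$ is limit computable in the jump (that is, there is a computable sequence $(p_n)_{n\in\mathbb{N}}$ in $\mathbb{N}^{\mathbb{N}}$ with $\lim_{n\to\infty}J(p_n)=J(p)$ in Baire space), then $f$ is not Turing reducible to $p$. -/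

import Mathlib

namespace Weihrauch

open Filter Topology

/-- Baire space `ℕ^ℕ`, with the product topology of the discrete topology on `ℕ`. -/
abbrev Baire := ℕ → ℕ

/-- Cantor space `{0,1}^ℕ`. -/
abbrev Cantor := ℕ → Bool

/-- The prefix `p(0) ... p(k-1)` of length `k` of a sequence `p`. -/
def prefixOf {α : Type*} (p : ℕ → α) (k : ℕ) : List α := (List.range k).map p

/-! ### Computability on Baire space -/

/-- A partial function `F` on Baire space is computable if there is a (type-2) machine which, on
every input `p` in the domain of `F`, writes the infinite output `F p` onto a one-way output tape.
The machine is given by the computable word function `h` sending a finite part `w` of the input to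
the finite part `h w` of the output that is produced from `w`. One-way output means that `h` is
monotone for the prefix order. Outside the domain of `F` nothing is required. -/
def ComputableMap (F : Baire →. Baire) : Prop :=
  ∃ h : List ℕ → List ℕ, Computable h ∧
    (∀ v w : List ℕ, v <+: w → h v <+: h w) ∧
    ∀ p : Baire, ∀ q ∈ F p, ∀ n : ℕ, ∃ k : ℕ, (h (prefixOf p k))[n]? = some (q n)

/-- The bijective pairing `⟨p, q⟩` of two points of Baire space (interleaving). -/
def pair (p q : Baire) : Baire := fun n => if n % 2 = 0 then p (n / 2) else q (n / 2)

/-- The `i`-th component `p_i` of `p = ⟨p_0, p_1, p_2, ...⟩`, where the bijective countable tupling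
is `⟨p_0, p_1, ...⟩ (Nat.pair i j) = p_i j`. -/
def component (p : Baire) (i : ℕ) : Baire := fun j => p (Nat.pair i j)

/-! ### Represented spaces, realizers and Weihrauch reducibility -/

/-- A represented space: a set `X` with a surjective partial map from Baire space onto `X`. -/
class RepresentedSpace (X : Type*) where
  /-- the representation -/
  rep : Baire →. X
  rep_surjective : ∀ x : X, ∃ p : Baire, x ∈ rep p

open RepresentedSpace

/-- A multi-valued partial map from `X` to `Y`; its domain consists of the points `x` for which
the set of values `f x` is nonempty. -/
abbrev MultiMap (X Y : Type*) := X → Set Y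

/-- `F` realizes `f`: for every name `p` of a point `x` in the domain of `f`, the value `F p` is
defined and is a name of some point of `f x`. -/
def Realizes {X Y : Type*} [RepresentedSpace X] [RepresentedSpace Y]
    (F : Baire →. Baire) (f : MultiMap X Y) : Prop :=
  ∀ p : Baire, ∀ x ∈ (rep p : Part X), (f x).Nonempty →
    ∃ q ∈ F p, ∃ y ∈ (rep q : Part Y), y ∈ f x

/-- Weihrauch reducibility: there are computable `K`, `H` such that `K ∘ ⟨id, G ∘ H⟩` realizes `f`
for every realizer `G` of `g`. -/
def WReducible {X Y U V : Type*} [RepresentedSpace X] [RepresentedSpace Y]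
    [RepresentedSpace U] [RepresentedSpace V] (f : MultiMap X Y) (g : MultiMap U V) : Prop :=
  ∃ K H : Baire →. Baire, ComputableMap K ∧ ComputableMap H ∧
    ∀ G : Baire →. Baire, Realizes G g →
      Realizes (fun p => (H p).bind fun r => (G r).bind fun s => K (pair p s)) f

/-- Strong Weihrauch reducibility: there are computable `K`, `H` such that `K ∘ G ∘ H` realizes `f`
for every realizer `G` of `g`. -/
def SWReducible {X Y U V : Type*} [RepresentedSpace X] [RepresentedSpace Y]
    [RepresentedSpace U] [RepresentedSpace V] (f : MultiMap X Y) (g : MultiMap U V) : Prop :=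
  ∃ K H : Baire →. Baire, ComputableMap K ∧ ComputableMap H ∧
    ∀ G : Baire →. Baire, Realizes G g →
      Realizes (fun p => (H p).bind fun r => (G r).bind fun s => K s) f

/-- Strict strong Weihrauch reducibility. -/
def StrictSWReducible {X Y U V : Type*} [RepresentedSpace X] [RepresentedSpace Y]
    [RepresentedSpace U] [RepresentedSpace V] (f : MultiMap X Y) (g : MultiMap U V) : Prop :=
  SWReducible f g ∧ ¬ SWReducible g f

/-- Baire space is represented by the identity. -/
instance : RepresentedSpace Baire where
  rep := fun p => Part.some p
  rep_surjective := fun x => ⟨x, Part.mem_some x⟩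

/-- Cantor space is represented by the restriction of the identity to 0-1-valued sequences. -/
instance : RepresentedSpace Cantor where
  rep := fun p => ⟨∀ n, p n = 0 ∨ p n = 1, fun _ n => decide (p n = 1)⟩
  rep_surjective := fun x => by
    refine ⟨fun n => (x n).toNat, fun n => ?_, funext fun n => ?_⟩
    · cases x n <;> simp
    · cases h : x n <;> simp [h]

/-- The ball `w {0,1}^ℕ` of all sequences in Cantor space that extend the word `w`. -/
def ball (w : List Bool) : Set Cantor := {x | prefixOf x w.length = w}

/-- The set of all points of Cantor space outside all balls `w {0,1}^ℕ` with `w` enumerated by `p`.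
The word `w` is listed through the value `code(w) + 1`; the value `0` lists nothing, so that the
enumeration may be empty. -/
def negativeSet (p : Baire) : Set Cantor :=
  {x | ∀ (i : ℕ) (w : List Bool), p i = Encodable.encode w + 1 → x ∉ ball w}

theorem prefixOf_eq_iff {α : Type*} (x y : ℕ → α) (k : ℕ) :
    prefixOf x k = prefixOf y k ↔ ∀ i < k, x i = y i := by
  simp [prefixOf]

theorem isOpen_ball (w : List Bool) : IsOpen (ball w) := by
  rw [isOpen_iff_forall_mem_open]
  intro x hx
  refine ⟨Set.pi (↑(Finset.range w.length)) fun i => {x i}, ?_, ?_, ?_⟩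
  · intro y hy
    have : prefixOf y w.length = prefixOf x w.length :=
      (prefixOf_eq_iff _ _ _).2 fun i hi => by simpa using hy i (by simpa using hi)
    exact this.trans hx
  · exact isOpen_set_pi (Finset.finite_toSet _) fun i _ => isOpen_discrete _
  · intro i _
    simp

theorem isClosed_negativeSet (p : Baire) : IsClosed (negativeSet p) := by
  have : negativeSet p =
      ⋂ (i : ℕ) (w : List Bool) (_ : p i = Encodable.encode w + 1), (ball w)ᶜ := by
    ext x
    simp [negativeSet]
  rw [this]
  exact isClosed_iInter fun i => isClosed_iInter fun w => isClosed_iInter fun _ =>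
    (isOpen_ball w).isClosed_compl

theorem exists_ball_subset {U : Set Cantor} (hU : IsOpen U) {x : Cantor} (hx : x ∈ U) :
    ∃ w, x ∈ ball w ∧ ball w ⊆ U := by
  obtain ⟨I, u, hu, hsub⟩ := isOpen_pi_iff.1 hU x hx
  refine ⟨prefixOf x (I.sup id + 1), by simp [ball, prefixOf], fun y hy => hsub fun i hi => ?_⟩
  have hlen : (prefixOf x (I.sup id + 1)).length = I.sup id + 1 := by simp [prefixOf]
  have hy' : prefixOf y (I.sup id + 1) = prefixOf x (I.sup id + 1) := by
    have := hy
    simp only [ball, Set.mem_ofPred_eq, hlen] at this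
    exact this
  have hle : i ≤ I.sup id := Finset.le_sup (f := id) hi
  rw [(prefixOf_eq_iff _ _ _).1 hy' i (by omega)]
  exact (hu i hi).2

open Classical in
/-- The space of closed subsets of Cantor space, with the negative information representation:
a name of `A` is an enumeration of words whose balls exhaust the complement of `A`. -/
noncomputable instance : RepresentedSpace (TopologicalSpace.Closeds Cantor) where
  rep := fun p => Part.some ⟨negativeSet p, isClosed_negativeSet p⟩
  rep_surjective := fun A => by
    refine ⟨fun i => if ∃ w : List Bool, Encodable.encode w = i ∧ Disjoint (ball w) (A : Set Cantor)
      then i + 1 else 0, ?_⟩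
    rw [Part.mem_some_iff]
    ext x
    change x ∈ A ↔ x ∈ negativeSet _
    constructor
    · intro hx i w hw hxw
      dsimp only at hw
      split_ifs at hw with h
      · obtain ⟨v, hv, hd⟩ := h
        have hvw : v = w := Encodable.encode_injective (by omega)
        subst hvw
        exact Set.disjoint_left.1 hd hxw hx
    · intro hx
      by_contra hxA
      obtain ⟨w, hxw, hw⟩ := exists_ball_subset A.isClosed.isOpen_compl hxA
      refine hx (Encodable.encode w) w ?_ hxw
      exact if_pos ⟨w, rfl, Set.disjoint_left.2 fun y hy => hw hy⟩

/-- Closed choice: given a nonempty closed set `A`, find some point of `A`. -/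
def closedChoice (X : Type*) [TopologicalSpace X] : MultiMap (TopologicalSpace.Closeds X) X :=
  fun A => (A : Set X)

/-! ### The Turing jump and limit operators -/

/-- The partial computable function `φ_i` of the standard Gödel numbering. -/
def phi (i : ℕ) : ℕ →. ℕ := (Denumerable.ofNat Nat.Partrec.Code i).eval

/-- The standard enumeration of the c.e. open subsets of Baire space: `ceOpen n` is the union of
the balls `w ℕ^ℕ` over all words `w` in the c.e. set with index `n`, i.e. the domain of `φ_n`. -/
def ceOpen (n : ℕ) : Set Baire := {p | ∃ k : ℕ, (phi n (Encodable.encode (prefixOf p k))).Dom}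

open Classical in
/-- The Turing jump operator `J` on Baire space. -/
noncomputable def jump (p : Baire) : Baire := fun n => if p ∈ ceOpen n then 1 else 0

/-- The initial topology of the jump: the coarsest topology on the domain of `jump` making
`jump` continuous into Baire space with its usual topology. -/
@[reducible]
noncomputable def jumpTopology : TopologicalSpace Baire := TopologicalSpace.induced jump inferInstance

/-- The limit map `⟨p_0, p_1, ...⟩ ↦ lim p_i` of Baire space, for the usual topology. -/
def limMap : MultiMap Baire Baire := fun p => {q | Tendsto (component p) atTop (𝓝 q)}

/-- The limit map `⟨p_0, p_1, ...⟩ ↦ lim p_i` for the initial topology of the jump. -/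
def limJ : MultiMap Baire Baire :=
  fun p => {q | Tendsto (component p) atTop (@nhds Baire jumpTopology q)}

/-- The map `L = J⁻¹ ∘ lim`. -/
def low : MultiMap Baire Baire := fun p => {r | jump r ∈ limMap p}

/-- `p` is limit computable in the jump: there is a computable sequence `(p_n)` of points of Baire
space such that `J(p_n)` converges to `J(p)`. -/
def LimitComputableInJump (p : Baire) : Prop :=
  ∃ s : ℕ → Baire, Computable₂ s ∧ Tendsto (fun n => jump (s n)) atTop (𝓝 (jump p))

/-- A total function `f` is diagonally non-computable if `f i ≠ φ_i(i)` for all `i`, including the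
case that `φ_i(i)` is undefined. -/
def DiagonallyNonComputable (f : ℕ → ℕ) : Prop := ∀ i : ℕ, f i ∉ phi i i

end Weihrauch

namespace Weihrauch

open Filter Topology Nat.Partrec

/-! ### Searching and semidecidable properties -/

/-! Convergence of `J(p_i)` to `J(q)` means that each c.e. open set eventually contains `p_i`
exactly when it contains `q`. All negative results exploit this: a c.e. open set is found that
misses `q` but contains rows `p_i` with arbitrarily large `i`.

Diagonal non-computability (`DiagonallyNonComputable.false_of_functional`): suppose `Φ` computes a
DNC function from `q`, and `J(s_n)` converges to `J(q)` for a computable sequence `s_n`. The c.e.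
open set "`Φ` outputs `φ_i(i)` at some `i`" misses `q`, hence misses all `s_n` with `n ≥ N`. A
search for a value of `Φ(s_n, i)` with `n ≥ N` is a partial computable function of `i`. At its own
index `c` it converges, so some `s_n` with `n ≥ N` gives the output `φ_c(c)`, a contradiction.
Closed choice reduces to this case, because the 0-1-valued DNC functions form a nonempty closed set
with a computable name.

The reduction of `limJ` to `low` approximates `J(q)` at stage `t` by running `t` steps on row `t -
1`; as `J` is injective, `L` returns `q` itself.

Against a strong reduction `K, H` of `low` to `limJ`, a computable `x` and a point `r` with `J(r) =
lim x` are built. Growing words `σ` determine `r`, and `x` approximates the jump of `σ000...`. When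
`K` on row `i` of `H(x)` shows a value `b` at a position beyond `σ`, then `σ` is padded to that
position and continued by `b + 1`, provided that this preserves the memberships below `σ.length`
already seen for `σ000...`. With finitely many extensions, `r = σ000...`, and the rows converge to a
point that `K` maps to `r`, so another extension is due. With infinitely many, the c.e. open set on
which `K` visibly disagrees with `r` misses `q` but contains rows of arbitrarily large index. -/

theorem exists_partrec_search {α β : Type*} [Primcodable α] [Primcodable β] {f : α × ℕ →. β}
    (hf : Partrec f) : ∃ h : α →. β, Partrec h ∧ (∀ a, ∀ z ∈ h a, ∃ i, z ∈ f (a, i)) ∧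
      ∀ a, (∃ i, (f (a, i)).Dom) → (h a).Dom := by
  obtain ⟨c, hc⟩ := Code.exists_code.1 hf
  have hc' : ∀ x y, y ∈ c.eval (Encodable.encode x) ↔ ∃ z ∈ f x, Encodable.encode z = y := by
    intro x y
    rw [hc]
    simp
  -- Dovetailing: `u` codes a candidate `i` together with a bound on the number of steps.
  let g : α → ℕ → Option β := fun a u =>
    (Code.evaln u.unpair.2 c (Encodable.encode (a, u.unpair.1))).bind Encodable.decode
  have hg : Computable₂ g := by
    have h1 : Computable fun x : α × ℕ => x.2.unpair :=
      Computable.unpair.comp Computable.snd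
    have h2 : Computable fun x : α × ℕ => Code.evaln x.2.unpair.2 c
        (Encodable.encode (x.1, x.2.unpair.1)) :=
      Code.primrec_evaln.to_comp.comp
        (((Computable.snd.comp h1).pair (Computable.const c)).pair
          (Computable.encode.comp (Computable.fst.pair (Computable.fst.comp h1))))
    exact Computable.option_bind h2 (Computable.decode.comp Computable.snd).to₂
  refine ⟨fun a => Nat.rfindOpt (g a), Partrec.rfindOpt hg, fun a z hz => ?_, fun a ⟨i, hi⟩ => ?_⟩
  · obtain ⟨u, hu⟩ := Nat.rfindOpt_spec hz
    obtain ⟨y, hy, hyz⟩ := Option.bind_eq_some_iff.1 hu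
    obtain ⟨z', hz', rfl⟩ := (hc' _ _).1 (Code.evaln_sound hy)
    rw [Encodable.encodek] at hyz
    exact ⟨_, Option.some_injective _ hyz ▸ hz'⟩
  · obtain ⟨z, hz⟩ := Part.dom_iff_mem.1 hi
    obtain ⟨t, ht⟩ := Code.evaln_complete.1 ((hc' _ _).2 ⟨z, hz, rfl⟩)
    refine Nat.rfindOpt_dom.2 ⟨Nat.pair i t, z, ?_⟩
    simp only [g, Nat.unpair_pair]
    exact Option.bind_eq_some_iff.2 ⟨_, ht, Encodable.encodek z⟩

theorem rePred_exists_dom {α β : Type*} [Primcodable α] [Primcodable β] {f : α × ℕ →. β}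
    (hf : Partrec f) : REPred fun a => ∃ i, (f (a, i)).Dom := by
  obtain ⟨h, hh, h1, h2⟩ := exists_partrec_search hf
  refine hh.dom_re.of_eq fun a => ⟨fun hd => ?_, h2 a⟩
  obtain ⟨i, hi⟩ := h1 a _ (Part.get_mem hd)
  exact ⟨i, Part.dom_iff_mem.2 ⟨_, hi⟩⟩

theorem exists_ceOpen {R : List ℕ → Prop} (hR : REPred R) :
    ∃ n, ∀ p, p ∈ ceOpen n ↔ ∃ k, R (prefixOf p k) := by
  obtain ⟨c, hc⟩ := Code.exists_code.1 hR
  refine ⟨Encodable.encode c, fun p => ?_⟩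
  have : ∀ w : List ℕ, (phi (Encodable.encode c) (Encodable.encode w)).Dom ↔ R w := by
    intro w
    rw [phi, Denumerable.ofNat_encode, hc]
    simp [Part.dom_iff_mem]
  simp only [ceOpen, Set.mem_ofPred_eq, this]

/-! ### Prefixes -/

section Prefix

variable {α : Type*} (p : ℕ → α)

@[simp] theorem length_prefixOf (k : ℕ) : (prefixOf p k).length = k := by simp [prefixOf]

theorem prefixOf_succ (k : ℕ) : prefixOf p (k + 1) = prefixOf p k ++ [p k] := by
  simp [prefixOf, List.range_succ]

theorem getElem?_prefixOf {k i : ℕ} (h : i < k) : (prefixOf p k)[i]? = some (p i) := by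
  simp [prefixOf, h]

theorem take_prefixOf {j k : ℕ} (h : j ≤ k) : (prefixOf p k).take j = prefixOf p j := by
  rw [prefixOf, ← List.map_take, List.take_range, min_eq_left h]; rfl

theorem prefixOf_isPrefix {j k : ℕ} (h : j ≤ k) : prefixOf p j <+: prefixOf p k := by
  rw [← take_prefixOf p h]; exact List.take_prefix _ _

theorem computable₂_prefixOf [Primcodable α] {β : Type*} [Primcodable β] {s : β → ℕ → α}
    (hs : Computable₂ s) :
    Computable₂ fun b k => prefixOf (s b) k := by
  have h : Computable fun x : β × ℕ => Nat.rec (motive := fun _ => List α) []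
      (fun k w => w ++ [s x.1 k]) x.2 := by
    have hstep : Computable₂ fun (x : β × ℕ) (y : ℕ × List α) => y.2 ++ [s x.1 y.1] :=
      Computable.list_concat.comp (Computable.snd.comp Computable.snd)
        (hs.comp (Computable.fst.comp Computable.fst) (Computable.fst.comp Computable.snd))
    exact Computable.nat_rec Computable.snd (Computable.const []) hstep
  refine h.of_eq fun ⟨b, k⟩ => ?_
  dsimp only
  induction k with
  | zero => simp [prefixOf]
  | succ k ih => rw [prefixOf_succ, ← ih]

theorem computable_prefixOf [Primcodable α] {p : ℕ → α} (hp : Computable p) :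
    Computable (prefixOf p) :=
  (computable₂_prefixOf (β := Unit) (s := fun _ => p)
    (Computable.to₂ (hp.comp Computable.snd))).comp (Computable.const ()) Computable.id

end Prefix

/-! ### The jump -/

theorem tendsto_baire {u : ℕ → Baire} {q : Baire} :
    Tendsto u atTop (𝓝 q) ↔ ∀ n, ∀ᶠ i in atTop, u i n = q n := by
  simp only [tendsto_pi_nhds, nhds_discrete, tendsto_pure]

theorem eventually_prefixOf_eq {u : ℕ → Baire} {q : Baire} (h : Tendsto u atTop (𝓝 q)) (k : ℕ) :
    ∀ᶠ i in atTop, prefixOf (u i) k = prefixOf q k := by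
  simp only [prefixOf_eq_iff]
  exact (Set.finite_Iio k).eventually_all.2 fun n _ => tendsto_baire.1 h n

theorem jump_eq_jump_iff {p q : Baire} {n : ℕ} :
    jump p n = jump q n ↔ (p ∈ ceOpen n ↔ q ∈ ceOpen n) := by
  unfold jump
  by_cases hp : p ∈ ceOpen n <;> by_cases hq : q ∈ ceOpen n <;> simp [hp, hq]

theorem tendsto_jump {u : ℕ → Baire} {q : Baire} :
    Tendsto (fun i => jump (u i)) atTop (𝓝 (jump q)) ↔
      ∀ n, ∀ᶠ i in atTop, (u i ∈ ceOpen n ↔ q ∈ ceOpen n) := by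
  simp only [tendsto_baire, jump_eq_jump_iff]

/-- Single entries are visible in the jump. Hence `J` is injective, and convergence of jumps implies
ordinary convergence. -/
theorem exists_ceOpen_apply_eq (i a : ℕ) : ∃ n, ∀ p : Baire, p ∈ ceOpen n ↔ p i = a := by
  have hR : REPred fun w : List ℕ => w[i]? = some a := by
    refine ComputablePred.to_re (PrimrecPred.computablePred ?_)
    exact Primrec.eq.comp (Primrec.list_getElem?.comp Primrec.id (Primrec.const i))
      (Primrec.const (some a))
  obtain ⟨n, hn⟩ := exists_ceOpen hR
  refine ⟨n, fun p => (hn p).trans ⟨?_, fun h => ⟨i + 1, ?_⟩⟩⟩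
  · rintro ⟨k, hk⟩
    have hik : i < k := by
      simpa using (List.getElem?_eq_some_iff.1 hk).1
    rw [getElem?_prefixOf p hik] at hk
    exact Option.some_injective _ hk
  · rw [getElem?_prefixOf p (Nat.lt_succ_self i), h]

theorem tendsto_of_tendsto_jump {u : ℕ → Baire} {q : Baire}
    (h : Tendsto (fun i => jump (u i)) atTop (𝓝 (jump q))) : Tendsto u atTop (𝓝 q) := by
  refine tendsto_baire.2 fun i => ?_
  obtain ⟨n, hn⟩ := exists_ceOpen_apply_eq i (q i)
  filter_upwards [tendsto_jump.1 h n] with j hj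
  rw [hn, hn] at hj
  exact hj.2 rfl

theorem jump_injective : Function.Injective jump := by
  intro p q h
  funext i
  obtain ⟨n, hn⟩ := exists_ceOpen_apply_eq i (q i)
  exact (hn p).1 ((jump_eq_jump_iff.1 (congrFun h n)).2 ((hn q).2 rfl))

theorem mem_limJ {p q : Baire} :
    q ∈ limJ p ↔ Tendsto (fun i => jump (component p i)) atTop (𝓝 (jump q)) := by
  unfold limJ
  rw [Set.mem_ofPred_eq, nhds_induced, tendsto_comap_iff]
  rfl

/-! ### Finite stages of the jump -/

/-- Within `m` steps, some prefix of `w` is seen to be in the c.e. set of words with index `n`. -/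
def StageMem (w : List ℕ) (m n : ℕ) : Prop :=
  ∃ k < w.length + 1,
    ((Denumerable.ofNat Code n).evaln m (Encodable.encode (w.take k))).isSome = true

instance (w : List ℕ) (m n : ℕ) : Decidable (StageMem w m n) := by
  unfold StageMem; infer_instance

theorem StageMem.mono {v w : List ℕ} {m m' n : ℕ} (h : StageMem v m n) (hvw : v <+: w)
    (hm : m ≤ m') : StageMem w m' n := by
  obtain ⟨k, hk, he⟩ := h
  refine ⟨k, hk.trans_le (Nat.succ_le_succ hvw.length_le), ?_⟩
  obtain ⟨t, rfl⟩ := hvw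
  rw [List.take_append_of_le_length (by omega)]
  obtain ⟨y, hy⟩ := Option.isSome_iff_exists.1 he
  exact Option.isSome_iff_exists.2 ⟨y, Code.evaln_mono hm hy⟩

theorem mem_ceOpen_iff_stageMem {p : Baire} {n : ℕ} :
    p ∈ ceOpen n ↔ ∃ k m, StageMem (prefixOf p k) m n := by
  constructor
  · rintro ⟨k, hk⟩
    obtain ⟨y, hy⟩ := Part.dom_iff_mem.1 hk
    obtain ⟨m, hm⟩ := Code.evaln_complete.1 hy
    refine ⟨k, m, k, by simp, ?_⟩
    rw [take_prefixOf p le_rfl]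
    exact Option.isSome_iff_exists.2 ⟨y, hm⟩
  · rintro ⟨k, m, j, hj, h⟩
    obtain ⟨y, hy⟩ := Option.isSome_iff_exists.1 h
    rw [take_prefixOf p (by simpa [Nat.lt_succ_iff] using hj)] at hy
    exact ⟨j, Part.dom_iff_mem.2 ⟨y, Code.evaln_sound hy⟩⟩

theorem primrecPred_stageMem {α : Type*} [Primcodable α] {w : α → List ℕ} {m n : α → ℕ}
    (hw : Primrec w) (hm : Primrec m) (hn : Primrec n) :
    PrimrecPred fun a => StageMem (w a) (m a) (n a) := by
  have hR : PrimrecRel fun (k : ℕ) (a : α) =>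
      ((Denumerable.ofNat Code (n a)).evaln (m a)
        (Encodable.encode ((w a).take k))).isSome = true := by
    refine Primrec.eq.comp (Primrec.option_isSome.comp ?_) (Primrec.const true)
    refine Code.primrec_evaln.comp (((hm.comp Primrec.snd).pair
      ((Primrec.ofNat Code).comp (hn.comp Primrec.snd))).pair (Primrec.encode.comp ?_))
    exact Primrec.list_take.comp Primrec.fst (hw.comp Primrec.snd)
  exact (hR.exists_mem_list.comp (Primrec.list_range.comp
    (Primrec.succ.comp (Primrec.list_length.comp hw))) Primrec.id).of_eq
    fun a => by simp [StageMem]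

/-! ### Monotone word functions -/

/-- The word function `h` produces only prefixes of `q` on input `p`, and arbitrarily long ones. -/
structure Produces (h : List ℕ → List ℕ) (p q : Baire) : Prop where
  sound : ∀ k n z, (h (prefixOf p k))[n]? = some z → z = q n
  complete : ∀ n, ∃ k₀, ∀ k ≥ k₀, (h (prefixOf p k))[n]? = some (q n)

/-- One-way output is never revised: comparison with a longer input prefix shows that every written
entry is correct and that it persists. -/
theorem exists_produces {F : Baire →. Baire} (hF : ComputableMap F) :
    ∃ h : List ℕ → List ℕ, Computable h ∧ (∀ v w, v <+: w → h v <+: h w) ∧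
      ∀ p, ∀ q ∈ F p, Produces h p q := by
  obtain ⟨h, hc, hm, hs⟩ := hF
  refine ⟨h, hc, hm, fun p q hq => ?_⟩
  have key : ∀ n, ∃ k₀, ∀ k ≥ k₀, (h (prefixOf p k))[n]? = some (q n) := by
    intro n
    obtain ⟨k₀, hk₀⟩ := hs p q hq n
    refine ⟨k₀, fun k hk => ?_⟩
    obtain ⟨t, ht⟩ := hm _ _ (prefixOf_isPrefix p hk)
    rw [← ht, List.getElem?_append_left (List.getElem?_eq_some_iff.1 hk₀).1, hk₀]
  refine ⟨fun k n z hz => ?_, key⟩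
  obtain ⟨k₀, hk₀⟩ := key n
  obtain ⟨t, ht⟩ := hm _ _ (prefixOf_isPrefix p (le_max_left k k₀))
  have h1 := hk₀ _ (le_max_right k k₀)
  rw [← ht, List.getElem?_append_left (List.getElem?_eq_some_iff.1 hz).1, hz] at h1
  exact Option.some_injective _ h1

theorem Produces.eventually_length {h : List ℕ → List ℕ} {p q : Baire} (H : Produces h p q)
    (N : ℕ) : ∃ k₀, ∀ k ≥ k₀, N < (h (prefixOf p k)).length := by
  obtain ⟨k₀, hk₀⟩ := H.complete N
  exact ⟨k₀, fun k hk => (List.getElem?_eq_some_iff.1 (hk₀ k hk)).1⟩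

theorem Produces.computable {h : List ℕ → List ℕ} {p q : Baire} (H : Produces h p q)
    (hh : Computable h) (hp : Computable p) : Computable q := by
  have hg : Computable₂ fun n k => (h (prefixOf p k))[n]? :=
    Computable.list_getElem?.comp
      (hh.comp ((computable_prefixOf hp).comp Computable.snd)) Computable.fst
  refine (Partrec.rfindOpt hg).of_eq_tot fun n => ?_
  obtain ⟨k, hk⟩ := H.complete n
  have hd : (Nat.rfindOpt fun k => (h (prefixOf p k))[n]?).Dom :=
    Nat.rfindOpt_dom.2 ⟨k, q n, hk k le_rfl⟩
  obtain ⟨j, hj⟩ := Nat.rfindOpt_spec (Part.get_mem hd)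
  rw [← H.sound j n _ hj]
  exact Part.get_mem hd

/-! ### Realizers -/

/-- `Realizes` allows arbitrary values outside the domain of `f`. A realizer undefined there lets
any value obtained inside a reduction be recognised as a value of `f`. -/
theorem exists_realizer (f : MultiMap Baire Baire) :
    ∃ G : Baire →. Baire, Realizes G f ∧ ∀ p, ∀ q ∈ G p, q ∈ f p := by
  refine ⟨fun p => ⟨(f p).Nonempty, fun h => h.some⟩, fun p x hx hne => ?_, fun p q hq => ?_⟩
  · obtain rfl := Part.mem_some_iff.1 hx
    exact ⟨hne.some, ⟨hne, rfl⟩, hne.some, Part.mem_some _, hne.some_mem⟩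
  · obtain ⟨hne, rfl⟩ := hq
    exact hne.some_mem

/-! ### Functionals of relative computability -/

/-- The partial function `f` is the value at `p` of the functional that `Φ` computes from finite
prefixes. -/
structure IsFunctional (Φ : List ℕ × ℕ →. ℕ) (p : Baire) (f : ℕ →. ℕ) : Prop where
  partrec : Partrec Φ
  mono : ∀ v w, v <+: w → ∀ x y, y ∈ Φ (v, x) → y ∈ Φ (w, x)
  mem_iff : ∀ x y, y ∈ f x ↔ ∃ k, y ∈ Φ (prefixOf p k, x)

theorem IsFunctional.of_partrec {f : ℕ →. ℕ} (hf : Partrec f) (p : Baire) :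
    IsFunctional (fun a => f a.2) p f :=
  ⟨hf.comp Computable.snd, fun _ _ _ _ _ h => h, fun _ _ => ⟨fun h => ⟨0, h⟩, fun ⟨_, h⟩ => h⟩⟩

theorem IsFunctional.mem_of_le {Φ : List ℕ × ℕ →. ℕ} {p : Baire} {f : ℕ →. ℕ}
    (H : IsFunctional Φ p f) {k k' x y : ℕ} (h : y ∈ Φ (prefixOf p k, x)) (hk : k ≤ k') :
    y ∈ Φ (prefixOf p k', x) :=
  H.mono _ _ (prefixOf_isPrefix p hk) _ _ h

theorem IsFunctional.oracle (p : Baire) : IsFunctional (fun a => (a.1[a.2]? : Option ℕ)) p p := by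
  refine ⟨(Computable.list_getElem?.comp Computable.fst Computable.snd).ofOption, ?_, ?_⟩
  · rintro v _ ⟨t, rfl⟩ x y h
    rw [Part.mem_ofOption] at h ⊢
    rw [List.getElem?_append_left (List.getElem?_eq_some_iff.1 h).1]
    exact h
  · intro x y
    simp only [PFun.coe_val, Part.mem_some_iff, Part.mem_ofOption]
    constructor
    · rintro rfl
      exact ⟨x + 1, getElem?_prefixOf p (Nat.lt_succ_self x)⟩
    · rintro ⟨k, hk⟩
      have hx : x < k := by simpa using (List.getElem?_eq_some_iff.1 hk).1
      rw [getElem?_prefixOf p hx] at hk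
      exact (Option.some_injective _ hk).symm

theorem IsFunctional.pair {Φ Ψ : List ℕ × ℕ →. ℕ} {p : Baire} {f g : ℕ →. ℕ}
    (hf : IsFunctional Φ p f) (hg : IsFunctional Ψ p g) :
    IsFunctional (fun a => (Φ a).bind fun y => (Ψ a).map fun z => Nat.pair y z) p
      fun n => Nat.pair <$> f n <*> g n := by
  refine ⟨?_, ?_, ?_⟩
  · refine hf.partrec.bind (Partrec.map (hg.partrec.comp Computable.fst) ?_)
    exact Primrec₂.natPair.to_comp.comp (Computable.snd.comp Computable.fst) Computable.snd
  · intro v w hvw x y h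
    simp only [Part.mem_bind_iff, Part.mem_map_iff] at h ⊢
    obtain ⟨a, ha, b, hb, rfl⟩ := h
    exact ⟨a, hf.mono _ _ hvw _ _ ha, b, hg.mono _ _ hvw _ _ hb, rfl⟩
  · intro x y
    simp only [seq_eq_bind_map, Part.bind_eq_bind, Part.map_eq_map, Part.mem_bind_iff,
      Part.mem_map_iff]
    constructor
    · rintro ⟨_, ⟨a, ha, rfl⟩, b, hb, rfl⟩
      obtain ⟨k, hk⟩ := (hf.mem_iff _ _).1 ha
      obtain ⟨l, hl⟩ := (hg.mem_iff _ _).1 hb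
      exact ⟨max k l, a, hf.mem_of_le hk (le_max_left _ _), b,
        hg.mem_of_le hl (le_max_right _ _), rfl⟩
    · rintro ⟨k, a, ha, b, hb, rfl⟩
      exact ⟨_, ⟨a, (hf.mem_iff _ _).2 ⟨k, ha⟩, rfl⟩, b, (hg.mem_iff _ _).2 ⟨k, hb⟩, rfl⟩

theorem IsFunctional.comp {Φ Ψ : List ℕ × ℕ →. ℕ} {p : Baire} {f g : ℕ →. ℕ}
    (hf : IsFunctional Φ p f) (hg : IsFunctional Ψ p g) :
    IsFunctional (fun a => (Ψ a).bind fun y => Φ (a.1, y)) p fun n => g n >>= f := by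
  refine ⟨?_, ?_, ?_⟩
  · exact hg.partrec.bind
      (hf.partrec.comp ((Computable.fst.comp Computable.fst).pair Computable.snd)).to₂
  · intro v w hvw x y h
    simp only [Part.mem_bind_iff] at h ⊢
    obtain ⟨a, ha, hb⟩ := h
    exact ⟨a, hg.mono _ _ hvw _ _ ha, hf.mono _ _ hvw _ _ hb⟩
  · intro x y
    refine (Part.mem_bind_iff (f := g x)).trans ?_
    simp only [Part.mem_bind_iff]
    constructor
    · rintro ⟨a, ha, hb⟩
      obtain ⟨k, hk⟩ := (hg.mem_iff _ _).1 ha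
      obtain ⟨l, hl⟩ := (hf.mem_iff _ _).1 hb
      exact ⟨max k l, a, hg.mem_of_le hk (le_max_left _ _), hf.mem_of_le hl (le_max_right _ _)⟩
    · rintro ⟨k, a, ha, hb⟩
      exact ⟨a, (hg.mem_iff _ _).2 ⟨k, ha⟩, (hf.mem_iff _ _).2 ⟨k, hb⟩⟩

theorem IsFunctional.prec {Φ Ψ : List ℕ × ℕ →. ℕ} {p : Baire} {f g : ℕ →. ℕ}
    (hf : IsFunctional Φ p f) (hg : IsFunctional Ψ p g) :
    IsFunctional (fun a => Nat.rec (motive := fun _ => Part ℕ) (Φ (a.1, a.2.unpair.1))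
        (fun y IH => IH.bind fun i => Ψ (a.1, Nat.pair a.2.unpair.1 (Nat.pair y i)))
        a.2.unpair.2) p
      fun n => Nat.rec (motive := fun _ => Part ℕ) (f n.unpair.1)
        (fun y IH => IH.bind fun i => g (Nat.pair n.unpair.1 (Nat.pair y i))) n.unpair.2 := by
  have hu : Computable fun a : List ℕ × ℕ => a.2.unpair := Computable.unpair.comp Computable.snd
  have hmono : ∀ v w, v <+: w → ∀ a n y,
      y ∈ Nat.rec (motive := fun _ => Part ℕ) (Φ (v, a))
        (fun y IH => IH.bind fun i => Ψ (v, Nat.pair a (Nat.pair y i))) n →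
      y ∈ Nat.rec (motive := fun _ => Part ℕ) (Φ (w, a))
        (fun y IH => IH.bind fun i => Ψ (w, Nat.pair a (Nat.pair y i))) n := by
    intro v w hvw a n
    induction n with
    | zero => exact hf.mono _ _ hvw _
    | succ n ih =>
      intro y h
      obtain ⟨b, hb, hy⟩ := Part.mem_bind_iff.1 h
      exact Part.mem_bind_iff.2 ⟨b, ih b hb, hg.mono _ _ hvw _ _ hy⟩
  refine ⟨?_, fun v w hvw x => hmono v w hvw _ _, fun x => ?_⟩
  · have hstep : Partrec₂ fun (a : List ℕ × ℕ) (b : ℕ × ℕ) =>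
        Ψ (a.1, Nat.pair a.2.unpair.1 (Nat.pair b.1 b.2)) := by
      refine hg.partrec.comp ((Computable.fst.comp Computable.fst).pair
        (Primrec₂.natPair.to_comp.comp (Computable.fst.comp (hu.comp Computable.fst)) ?_))
      exact Primrec₂.natPair.to_comp.comp (Computable.fst.comp Computable.snd)
        (Computable.snd.comp Computable.snd)
    exact Partrec.nat_rec (Computable.snd.comp hu)
      (hf.partrec.comp (Computable.fst.pair (Computable.fst.comp hu))) hstep
  · dsimp only
    generalize x.unpair.1 = a
    induction x.unpair.2 with
    | zero => exact hf.mem_iff _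
    | succ n ih =>
      intro y
      simp only [Part.mem_bind_iff]
      constructor
      · rintro ⟨b, hb, hy⟩
        obtain ⟨k, hk⟩ := (ih b).1 hb
        obtain ⟨l, hl⟩ := (hg.mem_iff _ _).1 hy
        exact ⟨max k l, b, hmono _ _ (prefixOf_isPrefix p (le_max_left _ _)) _ _ _ hk,
          hg.mem_of_le hl (le_max_right _ _)⟩
      · rintro ⟨k, b, hb, hy⟩
        exact ⟨b, (ih b).2 ⟨k, hb⟩, (hg.mem_iff _ _).2 ⟨k, hy⟩⟩

theorem IsFunctional.rfind {Φ : List ℕ × ℕ →. ℕ} {p : Baire} {f : ℕ →. ℕ}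
    (hf : IsFunctional Φ p f) :
    IsFunctional (fun a => Nat.rfind fun n =>
        (Φ (a.1, Nat.pair a.2 n)).map fun m => decide (m = 0)) p
      fun a => Nat.rfind fun n => (f (Nat.pair a n)).map fun m => decide (m = 0) := by
  refine ⟨?_, ?_, ?_⟩
  · refine Partrec.rfind (Partrec.map (hf.partrec.comp ?_) ?_)
    · exact (Computable.fst.comp Computable.fst).pair
        (Primrec₂.natPair.to_comp.comp (Computable.snd.comp Computable.fst) Computable.snd)
    · exact ((PrimrecRel.decide Primrec.eq).comp Primrec.snd (Primrec.const 0)).to_comp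
  · intro v w hvw x y h
    obtain ⟨h1, h2⟩ := Nat.mem_rfind.1 h
    refine Nat.mem_rfind.2 ⟨?_, fun {m} hm => ?_⟩
    · obtain ⟨b, hb, hb0⟩ := (Part.mem_map_iff _).1 h1
      exact (Part.mem_map_iff _).2 ⟨b, hf.mono _ _ hvw _ _ hb, hb0⟩
    · obtain ⟨b, hb, hb0⟩ := (Part.mem_map_iff _).1 (h2 hm)
      exact (Part.mem_map_iff _).2 ⟨b, hf.mono _ _ hvw _ _ hb, hb0⟩
  · intro x y
    have hiff : ∀ u : ℕ → Part ℕ, (y ∈ Nat.rfind fun n => (u n).map fun m => decide (m = 0)) ↔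
        (∃ b ∈ u y, decide (b = 0) = true) ∧ ∀ m < y, ∃ b ∈ u m, decide (b = 0) = false := by
      intro u
      refine Nat.mem_rfind.trans (and_congr (Part.mem_map_iff _) ?_)
      exact forall₂_congr fun m _ => Part.mem_map_iff _
    refine (hiff _).trans (Iff.trans ?_ (exists_congr fun k => (hiff _).symm))
    constructor
    · rintro ⟨⟨a, ha, ha0⟩, hlt⟩
      -- The hit at `y` and the misses below it are treated uniformly; the supremum of the finitely
      -- many prefix lengths then serves all of them.
      have hall : ∀ m ≤ y, ∃ k, ∃ b ∈ Φ (prefixOf p k, Nat.pair x m),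
          decide (b = 0) = decide (m = y) := by
        intro m hm
        rcases hm.eq_or_lt with rfl | hm
        · obtain ⟨k, hk⟩ := (hf.mem_iff _ _).1 ha
          exact ⟨k, a, hk, by simpa using ha0⟩
        · obtain ⟨b, hb, hb0⟩ := hlt m hm
          obtain ⟨k, hk⟩ := (hf.mem_iff _ _).1 hb
          exact ⟨k, b, hk, by simpa [hm.ne] using hb0⟩
      choose! k hk using hall
      have hle : ∀ m ≤ y, k m ≤ (Finset.range (y + 1)).sup k := fun m hm =>
        Finset.le_sup (f := k) (Finset.mem_range.2 (Nat.lt_succ_of_le hm))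
      refine ⟨(Finset.range (y + 1)).sup k, ?_, fun m hm => ?_⟩
      · obtain ⟨b, hb, hb0⟩ := hk y le_rfl
        exact ⟨b, hf.mem_of_le hb (hle y le_rfl), by simpa using hb0⟩
      · obtain ⟨b, hb, hb0⟩ := hk m hm.le
        exact ⟨b, hf.mem_of_le hb (hle m hm.le), by simpa [hm.ne] using hb0⟩
    · rintro ⟨k, ⟨a, ha, ha0⟩, hlt⟩
      refine ⟨⟨a, (hf.mem_iff _ _).2 ⟨k, ha⟩, ha0⟩, fun m hm => ?_⟩
      obtain ⟨b, hb, hb0⟩ := hlt m hm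
      exact ⟨b, (hf.mem_iff _ _).2 ⟨k, hb⟩, hb0⟩

/-- The use principle: a converging oracle computation reads a finite part of the oracle, a property
preserved by each closure rule. -/
theorem exists_isFunctional {p : Baire} {f : ℕ →. ℕ} (h : Nat.RecursiveIn {(p : ℕ →. ℕ)} f) :
    ∃ Φ, IsFunctional Φ p f := by
  induction h with
  | zero => exact ⟨_, .of_partrec (Partrec.nat_iff.2 .zero) p⟩
  | succ => exact ⟨_, .of_partrec (Partrec.nat_iff.2 .succ) p⟩
  | left => exact ⟨_, .of_partrec (Partrec.nat_iff.2 .left) p⟩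
  | right => exact ⟨_, .of_partrec (Partrec.nat_iff.2 .right) p⟩
  | oracle g hg =>
    obtain rfl := Set.mem_singleton_iff.1 hg
    exact ⟨_, .oracle p⟩
  | pair _ _ ihf ihg => exact ⟨_, ihf.choose_spec.pair ihg.choose_spec⟩
  | comp _ _ ihf ihg => exact ⟨_, ihf.choose_spec.comp ihg.choose_spec⟩
  | prec _ _ ihf ihg => exact ⟨_, ihf.choose_spec.prec ihg.choose_spec⟩
  | rfind _ ihf => exact ⟨_, ihf.choose_spec.rfind⟩

/-! ### Diagonally non-computable functions and limits in the jump -/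

theorem partrec_phi_self : Partrec fun i => phi i i :=
  Code.eval_part.comp (Computable.ofNat Code) Computable.id

/-- `Φ` need only be correct along `q`. This covers Turing functionals as well as an outer reduction
with a computable first argument. -/
theorem DiagonallyNonComputable.false_of_functional {f q : Baire} (hf : DiagonallyNonComputable f)
    (hq : LimitComputableInJump q) {Φ : List ℕ × ℕ →. ℕ} (hΦ : Partrec Φ)
    (hs : ∀ k i, ∀ y ∈ Φ (prefixOf q k, i), y = f i)
    (hc : ∀ i, ∃ k, f i ∈ Φ (prefixOf q k, i)) : False := by
  obtain ⟨s, hsc, hlim⟩ := hq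
  let ψ : List ℕ × ℕ →. Unit := fun a => (Φ a).bind fun y => (phi a.2 a.2).bind fun z =>
    ((if z = y then some () else none : Option Unit) : Part Unit)
  have hψ : Partrec ψ := by
    refine hΦ.bind (Partrec.bind (partrec_phi_self.comp (Computable.snd.comp Computable.fst)) ?_)
    refine Computable.ofOption (Primrec.to_comp ?_)
    exact Primrec.ite (Primrec.eq.comp Primrec.snd (Primrec.snd.comp Primrec.fst))
      (Primrec.const _) (Primrec.const _)
  have hdom : ∀ a, (ψ a).Dom ↔ ∃ y ∈ Φ a, y ∈ phi a.2 a.2 := by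
    intro a
    simp only [ψ, Part.dom_iff_mem, Part.mem_bind_iff, Part.mem_ofOption]
    constructor
    · rintro ⟨_, y, hy, z, hz, h⟩
      split_ifs at h with hzy
      · exact ⟨y, hy, hzy ▸ hz⟩
      · simp at h
    · rintro ⟨y, hy, hz⟩
      exact ⟨(), y, hy, y, hz, by simp⟩
  -- The c.e. open set of points on which `Φ` visibly violates diagonal non-computability.
  obtain ⟨n, hn⟩ := exists_ceOpen (rePred_exists_dom hψ)
  simp only [hdom] at hn
  have hqn : q ∉ ceOpen n := by
    rw [hn]
    rintro ⟨k, i, y, hy, hyi⟩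
    exact hf i (hs k i y hy ▸ hyi)
  obtain ⟨N, hN⟩ := eventually_atTop.1 (tendsto_jump.1 hlim n)
  obtain ⟨g, hg, hg1, hg2⟩ := exists_partrec_search
    (f := fun a : ℕ × ℕ => Φ (prefixOf (s (N + a.2.unpair.1)) a.2.unpair.2, a.1)) (by
      have hu : Computable fun a : ℕ × ℕ => a.2.unpair := Computable.unpair.comp Computable.snd
      refine hΦ.comp (((computable₂_prefixOf hsc).comp ?_ (Computable.snd.comp hu)).pair
        Computable.fst)
      exact Primrec.nat_add.to_comp.comp (Computable.const N) (Computable.fst.comp hu))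
  -- At the index `c` of `g`, the value found by the search is `φ_c(c)` by definition.
  obtain ⟨c, hcg⟩ := Code.exists_code.1 (Partrec.nat_iff.1 hg)
  have hd : (g (Encodable.encode c)).Dom := by
    obtain ⟨k, hk⟩ := hc (Encodable.encode c)
    -- The search succeeds since late `s_n` share with `q` the prefix on which `Φ` converges.
    obtain ⟨M, hM⟩ := eventually_atTop.1 (eventually_prefixOf_eq (tendsto_of_tendsto_jump hlim) k)
    refine hg2 _ ⟨Nat.pair M k, Part.dom_iff_mem.2 ⟨f (Encodable.encode c), ?_⟩⟩
    simp only [Nat.unpair_pair]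
    rwa [hM _ (Nat.le_add_left _ _)]
  obtain ⟨u, hu⟩ := hg1 _ _ (Part.get_mem hd)
  refine hqn ((hN _ (Nat.le_add_right N u.unpair.1)).1 ((hn _).2 ⟨_, _, _, hu, ?_⟩))
  rw [phi, Denumerable.ofNat_encode, hcg]
  exact Part.get_mem hd

theorem DiagonallyNonComputable.not_turingReducible {f p : ℕ → ℕ} (hf : DiagonallyNonComputable f)
    (hp : LimitComputableInJump p) : ¬ TuringReducible (f : ℕ →. ℕ) (p : ℕ →. ℕ) := by
  intro h
  obtain ⟨Φ, H⟩ := exists_isFunctional (RecursiveIn.iff_nat.1 h)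
  refine hf.false_of_functional hp H.partrec (fun k i y hy => ?_) fun i => ?_
  · simpa using (H.mem_iff i y).2 ⟨k, hy⟩
  · exact (H.mem_iff i (f i)).1 (by simp)

/-! ### Closed choice on Cantor space -/

/-- The word `w` ends in position `j` with the value of `φ_j(j)`, as seen within `t` steps. -/
def EndsDiagonally (w : List Bool) (t : ℕ) : Prop :=
  w.length ≠ 0 ∧ (Denumerable.ofNat Code (w.length - 1)).evaln t (w.length - 1) =
    some (w.getD (w.length - 1) false).toNat

instance (w : List Bool) (t : ℕ) : Decidable (EndsDiagonally w t) := by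
  unfold EndsDiagonally; infer_instance

/-- A computable enumeration of the complement of the class of all diagonally non-computable
points of Cantor space. -/
def dncName : Baire := fun m =>
  if EndsDiagonally ((Encodable.decode m.unpair.1).getD []) m.unpair.2 then m.unpair.1 + 1 else 0

theorem primrec_dncName : Primrec dncName := by
  have hw : Primrec fun m : ℕ => ((Encodable.decode m.unpair.1).getD [] : List Bool) :=
    Primrec.option_getD.comp (Primrec.decode.comp (Primrec.fst.comp Primrec.unpair))
      (Primrec.const [])
  have hl : Primrec fun m : ℕ =>
      ((Encodable.decode m.unpair.1).getD [] : List Bool).length - 1 :=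
    Primrec.nat_sub.comp (Primrec.list_length.comp hw) (Primrec.const 1)
  refine Primrec.ite (PrimrecPred.and (PrimrecPred.not (Primrec.eq.comp
    (Primrec.list_length.comp hw) (Primrec.const 0))) (Primrec.eq.comp ?_ ?_))
    (Primrec.succ.comp (Primrec.fst.comp Primrec.unpair)) (Primrec.const 0)
  · exact Code.primrec_evaln.comp (((Primrec.snd.comp Primrec.unpair).pair
      ((Primrec.ofNat Code).comp hl)).pair hl)
  · exact Primrec.option_some.comp ((Primrec.dom_finite Bool.toNat).comp
      ((Primrec.list_getD false).comp hw hl))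

/-- A word is enumerated once its last bit is seen to equal the diagonal value there, so a point is
removed exactly when one of its bits agrees with the diagonal. -/
theorem mem_negativeSet_dncName {x : Cantor} :
    x ∈ negativeSet dncName ↔ DiagonallyNonComputable fun j => (x j).toNat := by
  constructor
  · intro hx j hj
    obtain ⟨t, ht⟩ := Code.evaln_complete.1 hj
    refine hx (Nat.pair (Encodable.encode (prefixOf x (j + 1))) t) (prefixOf x (j + 1)) ?_ ?_
    · simp only [dncName, Nat.unpair_pair, Encodable.encodek, Option.getD_some]
      refine if_pos ⟨by simp, ?_⟩
      simp only [length_prefixOf, Nat.add_sub_cancel, List.getD_eq_getElem?_getD,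
        getElem?_prefixOf x (Nat.lt_succ_self j), Option.getD_some]
      exact ht
    · simp [ball]
  · intro hx m w hm hw
    unfold dncName at hm
    split_ifs at hm with h
    rw [show m.unpair.1 = Encodable.encode w by omega, Encodable.encodek, Option.getD_some] at h
    obtain ⟨h0, h1⟩ := h
    refine hx (w.length - 1) ?_
    have hget : w.getD (w.length - 1) false = x (w.length - 1) := by
      have hw' : prefixOf x w.length = w := hw
      conv_lhs => rw [← hw']
      rw [length_prefixOf, List.getD_eq_getElem?_getD, getElem?_prefixOf x (by omega),
        Option.getD_some]
    rw [hget] at h1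
    exact Code.evaln_sound h1

theorem exists_diagonallyNonComputable :
    ∃ x : Cantor, DiagonallyNonComputable fun j => (x j).toNat := by
  classical
  refine ⟨fun j => decide (0 ∈ phi j j), fun j hj => ?_⟩
  by_cases h : 0 ∈ phi j j
  · simp only [h, decide_true, Bool.toNat_true] at hj
    exact zero_ne_one (Part.mem_unique h hj)
  · simp only [h, decide_false, Bool.toNat_false] at hj

/-- The prefix of `pair p q` that is determined by `p` and a prefix `w` of `q`. -/
def interleave (p : Baire) (w : List ℕ) : List ℕ :=
  (List.range (2 * w.length)).map fun n => if n % 2 = 0 then p (n / 2) else w.getD (n / 2) 0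

theorem interleave_prefixOf (p q : Baire) (k : ℕ) :
    interleave p (prefixOf q k) = prefixOf (pair p q) (2 * k) := by
  unfold interleave
  rw [length_prefixOf]
  refine List.map_congr_left fun n hn => ?_
  have hn' : n / 2 < k := by have := List.mem_range.1 hn; omega
  rw [pair, List.getD_eq_getElem?_getD, getElem?_prefixOf q hn', Option.getD_some]

theorem primrec_interleave {p : Baire} (hp : Primrec p) : Primrec (interleave p) := by
  refine Primrec.list_map (Primrec.list_range.comp (Primrec.nat_mul.comp (Primrec.const 2)
    Primrec.list_length)) ?_
  have hdiv : Primrec fun x : List ℕ × ℕ => x.2 / 2 :=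
    Primrec.nat_div.comp Primrec.snd (Primrec.const 2)
  exact Primrec.ite (Primrec.eq.comp (Primrec.nat_mod.comp Primrec.snd (Primrec.const 2))
    (Primrec.const 0)) (hp.comp hdiv) ((Primrec.list_getD 0).comp Primrec.fst hdiv)

theorem limitComputableInJump_of_mem_limJ {p q : Baire} (hp : Computable p) (hq : q ∈ limJ p) :
    LimitComputableInJump q :=
  ⟨component p, hp.comp Primrec₂.natPair.to_comp, mem_limJ.1 hq⟩

theorem not_closedChoice_wReducible_limJ : ¬ WReducible (closedChoice Cantor) limJ := by
  rintro ⟨K, H, hK, hH, hred⟩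
  obtain ⟨G, hG, hGmem⟩ := exists_realizer limJ
  obtain ⟨x, hx⟩ := exists_diagonallyNonComputable
  obtain ⟨f, hf, y, hy, hyA⟩ := hred G hG dncName _ (Part.mem_some _)
    ⟨x, mem_negativeSet_dncName.2 hx⟩
  simp only [Part.mem_bind_iff] at hf
  obtain ⟨p, hp, q, hq, hf⟩ := hf
  obtain ⟨h, hh, -, hprod⟩ := exists_produces hH
  obtain ⟨k, hk, -, kprod⟩ := exists_produces hK
  have hpc : Computable p := (hprod _ _ hp).computable hh primrec_dncName.to_comp
  -- Names of Cantor points are 0-1 sequences, so the name produced is itself the DNC function.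
  have hfy : f = fun j => (y j).toNat := by
    obtain ⟨h01, rfl⟩ := hy
    funext j
    change f j = (decide (f j = 1)).toNat
    rcases h01 j with h0 | h1
    · simp [h0]
    · simp [h1]
  have hdnc : DiagonallyNonComputable f := hfy ▸ mem_negativeSet_dncName.1 hyA
  refine hdnc.false_of_functional (limitComputableInJump_of_mem_limJ hpc (hGmem _ _ hq))
    (Φ := fun a => ((k (interleave dncName a.1))[a.2]? : Option ℕ))
    (Computable.list_getElem?.comp (hk.comp ((primrec_interleave primrec_dncName).to_comp.comp
      Computable.fst)) Computable.snd).ofOption (fun j i z hz => ?_) fun i => ?_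
  · rw [Part.mem_ofOption, interleave_prefixOf] at hz
    exact (kprod _ _ hf).sound _ _ _ hz
  · obtain ⟨j, hj⟩ := (kprod _ _ hf).complete i
    refine ⟨j, ?_⟩
    rw [Part.mem_ofOption, interleave_prefixOf]
    exact hj _ (by omega)

/-! ### The limit with respect to the jump reduces to `low` -/

/-- The part of length `k` of the row `i` of a finite table `w`, with missing entries zero. -/
def rowPrefix (w : List ℕ) (i k : ℕ) : List ℕ :=
  (List.range k).map fun j => w.getD (Nat.pair i j) 0

theorem primrec_rowPrefix {α : Type*} [Primcodable α] {w : α → List ℕ} {i k : α → ℕ}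
    (hw : Primrec w) (hi : Primrec i) (hk : Primrec k) :
    Primrec fun a => rowPrefix (w a) (i a) (k a) :=
  Primrec.list_map (Primrec.list_range.comp hk) ((Primrec.list_getD 0).comp
    (hw.comp Primrec.fst) (Primrec₂.natPair.comp (hi.comp Primrec.fst) Primrec.snd))

/-- The approximation at stage `t = m.unpair.1` to the value of the jump of the limit of the rows
of `w` at position `m.unpair.2`; it reads only the positions of `w` below `m`. -/
def jumpApprox (w : List ℕ) (m : ℕ) : ℕ :=
  if StageMem (rowPrefix w (m.unpair.1 - 1) m.unpair.1) m.unpair.1 m.unpair.2 then 1 else 0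

/-- With `t = m.unpair.1`, the cells read satisfy `pair (t - 1) j < t² ≤ m`. Using row `t - 1`
instead of `t` thus lets output entry `m` depend only on input below `m`. -/
theorem pair_pred_lt {m j : ℕ} (hj : j < m.unpair.1) : Nat.pair (m.unpair.1 - 1) j < m := by
  have h1 : Nat.pair (m.unpair.1 - 1) j < m.unpair.1 * m.unpair.1 := by
    obtain ⟨t, ht⟩ : ∃ t, m.unpair.1 = t + 1 := ⟨m.unpair.1 - 1, by omega⟩
    rw [ht] at hj ⊢
    rw [Nat.add_sub_cancel]
    calc Nat.pair t j < (max t j + 1) ^ 2 := Nat.pair_lt_max_add_one_sq _ _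
      _ = (t + 1) * (t + 1) := by rw [max_eq_left (by omega), sq]
  have h2 : m.unpair.1 * m.unpair.1 ≤ m := by
    conv_rhs => rw [← Nat.pair_unpair m, Nat.pair]
    split_ifs with h
    · have := Nat.mul_le_mul h.le h.le
      omega
    · omega
  omega

theorem rowPrefix_congr {v w : List ℕ} {m : ℕ} (h : ∀ j < m, v[j]? = w[j]?) :
    rowPrefix v (m.unpair.1 - 1) m.unpair.1 = rowPrefix w (m.unpair.1 - 1) m.unpair.1 := by
  refine List.map_congr_left fun j hj => ?_
  rw [List.getD_eq_getElem?_getD, List.getD_eq_getElem?_getD,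
    h _ (pair_pred_lt (List.mem_range.1 hj))]

theorem rowPrefix_prefixOf (p : Baire) {k i l : ℕ} (h : ∀ j < l, Nat.pair i j < k) :
    rowPrefix (prefixOf p k) i l = prefixOf (component p i) l := by
  refine List.map_congr_left fun j hj => ?_
  rw [List.getD_eq_getElem?_getD, getElem?_prefixOf p (h j (List.mem_range.1 hj)),
    Option.getD_some, component]

theorem computableMap_id : ComputableMap fun p => Part.some p := by
  refine ⟨id, Computable.id, fun _ _ h => h, fun p q hq n => ⟨n + 1, ?_⟩⟩
  rw [Part.mem_some_iff.1 hq]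
  exact getElem?_prefixOf p (Nat.lt_succ_self n)

theorem computableMap_jumpApprox :
    ComputableMap fun p => Part.some fun m => jumpApprox (prefixOf p m) m := by
  have hg : Primrec₂ jumpApprox := by
    have ht : Primrec fun x : List ℕ × ℕ => x.2.unpair.1 :=
      Primrec.fst.comp (Primrec.unpair.comp Primrec.snd)
    have hr := primrec_rowPrefix Primrec.fst (Primrec.pred.comp ht) ht
    exact Primrec.ite (primrecPred_stageMem hr ht
      (Primrec.snd.comp (Primrec.unpair.comp Primrec.snd))) (Primrec.const 1) (Primrec.const 0)
  refine ⟨fun w => (List.range w.length).map (jumpApprox w), Primrec.to_comp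
    (Primrec.list_map (Primrec.list_range.comp Primrec.list_length) hg), ?_, ?_⟩
  · rintro v _ ⟨t, rfl⟩
    have hv : (List.range v.length).map (jumpApprox v) =
        (List.range v.length).map (jumpApprox (v ++ t)) := by
      refine List.map_congr_left fun m hm => ?_
      unfold jumpApprox
      rw [rowPrefix_congr (w := v ++ t) fun j hj => ?_]
      rw [List.getElem?_append_left (hj.trans (List.mem_range.1 hm))]
    dsimp only
    rw [hv, List.length_append, List.range_add, List.map_append]
    exact List.prefix_append _ _
  · intro p q hq n
    rw [Part.mem_some_iff.1 hq]
    refine ⟨n + 1, ?_⟩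
    dsimp only
    rw [length_prefixOf, List.getElem?_map, List.getElem?_range (Nat.lt_succ_self n),
      Option.map_some]
    unfold jumpApprox
    rw [rowPrefix_congr (w := prefixOf p n) fun j hj => ?_]
    rw [getElem?_prefixOf p hj, getElem?_prefixOf p (hj.trans (Nat.lt_succ_self n))]

/-- A criterion for a table to converge to a jump. -/
theorem jump_mem_limMap {x r : Baire}
    (h1 : ∀ n, r ∈ ceOpen n → ∀ᶠ t in atTop, x (Nat.pair t n) = 1)
    (h0 : ∀ n, r ∉ ceOpen n → ∀ᶠ t in atTop, x (Nat.pair t n) = 0) : jump r ∈ limMap x := by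
  refine tendsto_baire.2 fun n => ?_
  by_cases hr : r ∈ ceOpen n
  · simpa [jump, hr, component] using h1 n hr
  · simpa [jump, hr, component] using h0 n hr

/-- Memberships are found because late rows share a witnessing prefix with `q`; false ones disappear
because late rows lie outside `ceOpen n`, which is where convergence of the jumps is needed. -/
theorem jump_mem_limMap_jumpApprox {p q : Baire} (hq : q ∈ limJ p) :
    jump q ∈ limMap fun m => jumpApprox (prefixOf p m) m := by
  have hlim := mem_limJ.1 hq
  have happ : ∀ t n, jumpApprox (prefixOf p (Nat.pair t n)) (Nat.pair t n) =
      if StageMem (prefixOf (component p (t - 1)) t) t n then 1 else 0 := by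
    intro t n
    have := rowPrefix_prefixOf p (k := Nat.pair t n) (i := t - 1) (l := t) fun j hj => by
      have := pair_pred_lt (m := Nat.pair t n) (j := j) (by simpa using hj)
      simpa using this
    unfold jumpApprox
    rw [Nat.unpair_pair, this]
  refine jump_mem_limMap (fun n hn => ?_) fun n hn => ?_
  · obtain ⟨k, m, hkm⟩ := mem_ceOpen_iff_stageMem.1 hn
    have hpre := (tendsto_sub_atTop_nat 1).eventually
      (eventually_prefixOf_eq (tendsto_of_tendsto_jump hlim) k)
    filter_upwards [hpre, eventually_ge_atTop k, eventually_ge_atTop m] with t ht hk hm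
    rw [happ, if_pos]
    exact hkm.mono (ht ▸ prefixOf_isPrefix _ hk) hm
  · filter_upwards [(tendsto_sub_atTop_nat 1).eventually (tendsto_jump.1 hlim n)] with t ht
    rw [happ, if_neg]
    exact fun h => hn (ht.1 (mem_ceOpen_iff_stageMem.2 ⟨_, _, h⟩))

theorem limJ_swReducible_low : SWReducible limJ low := by
  refine ⟨_, _, computableMap_id, computableMap_jumpApprox, fun G hG p x hx hne => ?_⟩
  obtain rfl := Part.mem_some_iff.1 hx
  obtain ⟨q, hq⟩ := hne
  have hlim := jump_mem_limMap_jumpApprox hq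
  obtain ⟨s, hs, y, hy, hyl⟩ := hG _ _ (Part.mem_some _) ⟨q, hlim⟩
  obtain rfl := Part.mem_some_iff.1 hy
  have hyq : y = q := jump_injective (tendsto_nhds_unique hyl hlim)
  refine ⟨y, ?_, y, Part.mem_some _, hyq ▸ hq⟩
  simpa [Part.mem_bind_iff] using hs

/-! ### A computable sequence that diagonalizes against a reduction of `low` to `limJ` -/

/-- Extend a word by zeros to length `k`. -/
def padTo (w : List ℕ) (k : ℕ) : List ℕ := w ++ List.replicate (k - w.length) 0

theorem length_padTo {w : List ℕ} {k : ℕ} (h : w.length ≤ k) : (padTo w k).length = k := by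
  simp [padTo, h]

theorem primrec₂_padTo : Primrec₂ padTo := by
  have h : Primrec₂ fun (w : List ℕ) k => w ++ (List.range (k - w.length)).map fun _ => 0 :=
    Primrec.list_append.comp Primrec.fst (Primrec.list_map (Primrec.list_range.comp
      (Primrec.nat_sub.comp Primrec.snd (Primrec.list_length.comp Primrec.fst)))
      (Primrec.const 0).to₂)
  exact h.of_eq fun w k => by simp [padTo, List.map_const']

/-- The position in the output that is considered at stage `m`. -/
def stagePos (m : ℕ) : ℕ := m.unpair.1.unpair.1

/-- The row that is considered at stage `m`. -/
def stageRow (m : ℕ) : ℕ := m.unpair.1.unpair.2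

/-- The length up to which the row is considered at stage `m`. -/
def stageLen (m : ℕ) : ℕ := m.unpair.2.unpair.1

/-- The word `σ` may be extended beyond position `stagePos m`: the row under consideration is
available in `o`, and the extension respects the part of the jump below `σ.length` that is
forced by zeros. -/
def Ready (o σ : List ℕ) (m : ℕ) : Prop :=
  (σ.length ≤ stagePos m ∧ σ.length ≤ stageRow m ∧ Nat.pair (stageRow m) (stageLen m) ≤ o.length) ∧
    ∀ n < σ.length, ¬ StageMem (padTo σ (σ.length + m)) m n ∨ StageMem (padTo σ (stagePos m)) m n

instance (o σ : List ℕ) (m : ℕ) : Decidable (Ready o σ m) := by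
  unfold Ready; infer_instance

/-- One step of the construction, for the output `o` of the inner reduction so far and the word
function `h` of the outer reduction. -/
def nextWord (h : List ℕ → List ℕ) (o σ : List ℕ) (m : ℕ) : List ℕ :=
  if Ready o σ m then
    ((h (rowPrefix o (stageRow m) (stageLen m)))[stagePos m]?.map fun b =>
      padTo σ (stagePos m) ++ [b + 1]).getD σ
  else σ

/-- The entry at position `m` of the approximation to the jump of `σ000...`. -/
def zeroApprox (σ : List ℕ) (m : ℕ) : ℕ :=
  if StageMem (padTo σ (σ.length + m)) m m.unpair.2 then 1 else 0

theorem primrec_stagePos : Primrec stagePos :=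
  Primrec.fst.comp (Primrec.unpair.comp (Primrec.fst.comp Primrec.unpair))

theorem primrec_stageRow : Primrec stageRow :=
  Primrec.snd.comp (Primrec.unpair.comp (Primrec.fst.comp Primrec.unpair))

theorem primrec_stageLen : Primrec stageLen :=
  Primrec.fst.comp (Primrec.unpair.comp (Primrec.snd.comp Primrec.unpair))

theorem primrec_zeroApprox : Primrec₂ zeroApprox := by
  have hp : Primrec fun x : List ℕ × ℕ => padTo x.1 (x.1.length + x.2) :=
    primrec₂_padTo.comp Primrec.fst
      (Primrec.nat_add.comp (Primrec.list_length.comp Primrec.fst) Primrec.snd)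
  exact Primrec.ite (primrecPred_stageMem hp Primrec.snd
    (Primrec.snd.comp (Primrec.unpair.comp Primrec.snd))) (Primrec.const 1) (Primrec.const 0)

theorem primrecPred_ready :
    PrimrecPred fun a : List ℕ × List ℕ × ℕ => Ready a.1 a.2.1 a.2.2 := by
  have hσ : Primrec fun a : List ℕ × List ℕ × ℕ => a.2.1 := Primrec.fst.comp Primrec.snd
  have hm : Primrec fun a : List ℕ × List ℕ × ℕ => a.2.2 := Primrec.snd.comp Primrec.snd
  have hl := Primrec.list_length.comp hσ
  have hR : PrimrecRel fun (n : ℕ) (a : List ℕ × List ℕ × ℕ) =>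
      ¬ StageMem (padTo a.2.1 (a.2.1.length + a.2.2)) a.2.2 n ∨
        StageMem (padTo a.2.1 (stagePos a.2.2)) a.2.2 n := by
    have hσ' := hσ.comp (Primrec.snd (α := ℕ) (β := List ℕ × List ℕ × ℕ))
    have hm' := hm.comp (Primrec.snd (α := ℕ) (β := List ℕ × List ℕ × ℕ))
    have h1 := primrec₂_padTo.comp hσ' (Primrec.nat_add.comp (Primrec.list_length.comp hσ') hm')
    have h2 := primrec₂_padTo.comp hσ' (primrec_stagePos.comp hm')
    exact PrimrecPred.or
      (PrimrecPred.not (primrecPred_stageMem h1 hm' Primrec.fst))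
      (primrecPred_stageMem h2 hm' Primrec.fst)
  refine PrimrecPred.and (PrimrecPred.and ?_ (PrimrecPred.and ?_ ?_)) ?_
  · exact Primrec.nat_le.comp hl (primrec_stagePos.comp hm)
  · exact Primrec.nat_le.comp hl (primrec_stageRow.comp hm)
  · exact Primrec.nat_le.comp (Primrec₂.natPair.comp (primrec_stageRow.comp hm)
      (primrec_stageLen.comp hm)) (Primrec.list_length.comp Primrec.fst)
  · exact (hR.forall_mem_list.comp (Primrec.list_range.comp hl) Primrec.id).of_eq
      fun a => by simp

theorem computable_nextWord {h : List ℕ → List ℕ} (hh : Computable h) :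
    Computable fun a : List ℕ × List ℕ × ℕ => nextWord h a.1 a.2.1 a.2.2 := by
  have hσ : Primrec fun a : List ℕ × List ℕ × ℕ => a.2.1 := Primrec.fst.comp Primrec.snd
  have hm : Primrec fun a : List ℕ × List ℕ × ℕ => a.2.2 := Primrec.snd.comp Primrec.snd
  have hpos := primrec_stagePos.comp hm
  have hrow := primrec_rowPrefix Primrec.fst (primrec_stageRow.comp hm) (primrec_stageLen.comp hm)
  have hget := Computable.list_getElem?.comp (hh.comp hrow.to_comp) hpos.to_comp
  have happ : Computable₂ fun (a : List ℕ × List ℕ × ℕ) (b : ℕ) =>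
      padTo a.2.1 (stagePos a.2.2) ++ [b + 1] :=
    Primrec.to_comp (Primrec.list_concat.comp ((primrec₂_padTo.comp hσ hpos).comp Primrec.fst)
      (Primrec.succ.comp Primrec.snd))
  refine (Computable.cond primrecPred_ready.computablePred.decide
    (Computable.option_getD (Computable.option_map hget happ) hσ.to_comp) hσ.to_comp).of_eq
    fun a => ?_
  unfold nextWord
  by_cases hr : Ready a.1 a.2.1 a.2.2 <;> simp [hr]

theorem prefix_nextWord (h : List ℕ → List ℕ) (o σ : List ℕ) (m : ℕ) :
    σ <+: nextWord h o σ m := by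
  unfold nextWord
  split_ifs
  · cases (h (rowPrefix o (stageRow m) (stageLen m)))[stagePos m]? with
    | none => exact List.prefix_rfl
    | some b => exact ⟨List.replicate (stagePos m - σ.length) 0 ++ [b + 1], by simp [padTo]⟩
  · exact List.prefix_rfl

theorem nextWord_of_ready {h : List ℕ → List ℕ} {o σ : List ℕ} {m b : ℕ} (hr : Ready o σ m)
    (hb : (h (rowPrefix o (stageRow m) (stageLen m)))[stagePos m]? = some b) :
    nextWord h o σ m = padTo σ (stagePos m) ++ [b + 1] := by
  rw [nextWord, if_pos hr, hb]; rfl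

theorem exists_of_nextWord_ne {h : List ℕ → List ℕ} {o σ : List ℕ} {m : ℕ}
    (hne : nextWord h o σ m ≠ σ) : Ready o σ m ∧
      ∃ b, (h (rowPrefix o (stageRow m) (stageLen m)))[stagePos m]? = some b := by
  unfold nextWord at hne
  split_ifs at hne with hr
  · refine ⟨hr, Option.ne_none_iff_exists'.1 fun hn => hne ?_⟩
    rw [hn]; rfl
  · exact absurd rfl hne

/-- The words `σ m` and the sequence `x` result from the construction for the word functions `g`
and `h` of the inner and outer reduction. -/
structure IsConstruction (g h : List ℕ → List ℕ) (σ : ℕ → List ℕ) (x : Baire) : Prop where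
  computable : Computable σ
  succ : ∀ m, σ (m + 1) = nextWord h (g (prefixOf x m)) (σ m) m
  apply : ∀ m, x m = zeroApprox (σ m) m

/-- No fixed-point argument is needed: stage `m` consults only the first `m` entries of `x`, so the
word and this prefix are computed by a joint recursion. -/
theorem exists_isConstruction {g h : List ℕ → List ℕ} (hg : Computable g) (hh : Computable h) :
    ∃ σ x, IsConstruction g h σ x := by
  let step : ℕ → List ℕ × List ℕ → List ℕ × List ℕ := fun m a =>
    (nextWord h (g a.2) a.1 m, a.2 ++ [zeroApprox a.1 m])
  let st : ℕ → List ℕ × List ℕ := fun m => Nat.rec ([], []) step m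
  have hstep : Computable fun b : ℕ × List ℕ × List ℕ => step b.1 b.2 := by
    have h1 : Computable fun b : ℕ × List ℕ × List ℕ => b.2.1 := Computable.fst.comp Computable.snd
    have h2 : Computable fun b : ℕ × List ℕ × List ℕ => b.2.2 := Computable.snd.comp Computable.snd
    exact ((computable_nextWord hh).comp ((hg.comp h2).pair (h1.pair Computable.fst))).pair
      (Computable.list_concat.comp h2 (primrec_zeroApprox.to_comp.comp h1 Computable.fst))
  have hst : Computable st :=
    Computable.nat_rec Computable.id (Computable.const ([], [])) (hstep.comp Computable.snd).to₂
  let x : Baire := fun m => zeroApprox (st m).1 m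
  have hx : ∀ m, (st m).2 = prefixOf x m := by
    intro m
    induction m with
    | zero => rfl
    | succ m ih => rw [prefixOf_succ, ← ih]
  refine ⟨fun m => (st m).1, x, Computable.fst.comp hst, fun m => ?_, fun m => rfl⟩
  rw [← hx]

theorem exists_limit_of_chain {σ : ℕ → List ℕ} (hσ : ∀ m n, m ≤ n → σ m <+: σ n) :
    ∃ r : Baire, (∀ m, prefixOf r (σ m).length = σ m) ∧
      ∀ j, (∀ m, (σ m).length ≤ j) → r j = 0 := by
  classical
  refine ⟨fun j => if H : ∃ m, j < (σ m).length then (σ H.choose)[j]'H.choose_spec else 0,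
    fun m => ?_, fun j hj => dif_neg fun ⟨m, hm⟩ => (hj m).not_gt hm⟩
  refine List.ext_getElem (by simp) fun j h1 h2 => ?_
  have H : ∃ m, j < (σ m).length := ⟨m, h2⟩
  simp only [prefixOf, List.getElem_map, List.getElem_range]
  rw [dif_pos H]
  rcases le_total H.choose m with hle | hle
  · exact (hσ _ _ hle).getElem H.choose_spec
  · exact ((hσ _ _ hle).getElem h2).symm

theorem padTo_prefixOf {r : Baire} {σ : List ℕ} (h : prefixOf r σ.length = σ)
    (h0 : ∀ j, σ.length ≤ j → r j = 0) {k : ℕ} (hk : σ.length ≤ k) :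
    padTo σ k = prefixOf r k := by
  refine List.ext_getElem (by simp [length_padTo hk]) fun j h1 h2 => ?_
  by_cases hj : j < σ.length
  · have hj' := getElem?_prefixOf r hj
    rw [h, List.getElem?_eq_getElem hj] at hj'
    simpa [padTo, hj, prefixOf] using hj'
  · simp [padTo, List.getElem_append_right (not_lt.1 hj), prefixOf, h0 j (not_lt.1 hj)]

theorem Produces.rowPrefix_eq {h : List ℕ → List ℕ} {x p : Baire} (H : Produces h x p)
    {m i k : ℕ} (hk : Nat.pair i k ≤ (h (prefixOf x m)).length) :
    rowPrefix (h (prefixOf x m)) i k = prefixOf (component p i) k := by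
  refine List.map_congr_left fun j hj => ?_
  -- `Nat.pair i` is increasing, so only entries already produced are read and the default zero is
  -- never used.
  have hlt := (Nat.pair_lt_pair_right i (List.mem_range.1 hj)).trans_le hk
  rw [List.getD_eq_getElem?_getD, List.getElem?_eq_getElem hlt, Option.getD_some]
  exact H.sound m _ _ (List.getElem?_eq_getElem hlt)

/-! ### Verification of the construction: finitely or infinitely many extensions -/

namespace IsConstruction

variable {g h : List ℕ → List ℕ} {σ : ℕ → List ℕ} {x r : Baire}

theorem prefix_of_le (C : IsConstruction g h σ x) {m n : ℕ} (hmn : m ≤ n) : σ m <+: σ n := by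
  induction n, hmn using Nat.le_induction with
  | base => exact List.prefix_rfl
  | succ n _ ih => exact ih.trans (C.succ n ▸ prefix_nextWord _ _ _ _)

theorem step_of_ne (C : IsConstruction g h σ x) {m : ℕ} (hne : σ (m + 1) ≠ σ m) :
    Ready (g (prefixOf x m)) (σ m) m ∧ ∃ b,
      (h (rowPrefix (g (prefixOf x m)) (stageRow m) (stageLen m)))[stagePos m]? = some b ∧
      σ (m + 1) = padTo (σ m) (stagePos m) ++ [b + 1] := by
  rw [C.succ] at hne ⊢
  obtain ⟨hr, b, hb⟩ := exists_of_nextWord_ne hne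
  exact ⟨hr, b, hb, nextWord_of_ready hr hb⟩

theorem exists_le_length (C : IsConstruction g h σ x)
    (hinf : ∀ M, ∃ m ≥ M, σ (m + 1) ≠ σ m) (k : ℕ) : ∃ m, k ≤ (σ m).length := by
  induction k with
  | zero => exact ⟨0, Nat.zero_le _⟩
  | succ k ih =>
    obtain ⟨M, hM⟩ := ih
    obtain ⟨m, hm, hne⟩ := hinf M
    obtain ⟨hr, b, -, hb⟩ := C.step_of_ne hne
    have := (C.prefix_of_le hm).length_le
    refine ⟨m + 1, ?_⟩
    rw [hb, List.length_append, length_padTo hr.1.1, List.length_singleton]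
    exact Nat.succ_le_succ (hM.trans (this.trans hr.1.1))

theorem zeroApprox_eq_one_iff (σ : List ℕ) (t n : ℕ) : zeroApprox σ (Nat.pair t n) = 1 ↔
    StageMem (padTo σ (σ.length + Nat.pair t n)) (Nat.pair t n) n := by
  unfold zeroApprox
  split_ifs with h <;> simpa using h

theorem zeroApprox_eq_zero_iff (σ : List ℕ) (t n : ℕ) : zeroApprox σ (Nat.pair t n) = 0 ↔
    ¬ StageMem (padTo σ (σ.length + Nat.pair t n)) (Nat.pair t n) n := by
  unfold zeroApprox
  split_ifs with h <;> simpa using h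

theorem jump_mem_limMap_of_finite (C : IsConstruction g h σ x)
    (hr : ∀ m, prefixOf r (σ m).length = σ m) {M : ℕ} (hfin : ∀ m ≥ M, σ m = σ M)
    (h0 : ∀ j, (σ M).length ≤ j → r j = 0) : jump r ∈ limMap x := by
  have hpad : ∀ m ≥ M, padTo (σ m) ((σ m).length + m) = prefixOf r ((σ M).length + m) := by
    intro m hm
    rw [hfin m hm]
    exact padTo_prefixOf (hr M) h0 (Nat.le_add_right _ _)
  refine jump_mem_limMap (fun n hn => ?_) fun n hn => ?_
  · obtain ⟨k, m, hkm⟩ := mem_ceOpen_iff_stageMem.1 hn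
    filter_upwards [eventually_ge_atTop (max M (max k m))] with t ht
    have ht' := ht.trans (Nat.left_le_pair t n)
    simp only [max_le_iff] at ht'
    rw [C.apply, zeroApprox_eq_one_iff, hpad _ ht'.1]
    exact hkm.mono (prefixOf_isPrefix r (by omega)) ht'.2.2
  · filter_upwards [eventually_ge_atTop M] with t ht
    rw [C.apply, zeroApprox_eq_zero_iff, hpad _ (ht.trans (Nat.left_le_pair t n))]
    exact fun hst => hn (mem_ceOpen_iff_stageMem.2 ⟨_, _, hst⟩)

/-- Once `σ` is longer than `n`, a membership claimed for `σ000...` is inherited by `r`: the next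
extension is allowed only if the padded word, a prefix of `r`, already witnesses it. -/
theorem jump_mem_limMap_of_infinite (C : IsConstruction g h σ x)
    (hr : ∀ m, prefixOf r (σ m).length = σ m) (hinf : ∀ M, ∃ m ≥ M, σ (m + 1) ≠ σ m) :
    jump r ∈ limMap x := by
  refine jump_mem_limMap (fun n hn => ?_) fun n hn => ?_
  · obtain ⟨k, m, hkm⟩ := mem_ceOpen_iff_stageMem.1 hn
    obtain ⟨M, hM⟩ := C.exists_le_length hinf k
    filter_upwards [eventually_ge_atTop (max M m)] with t ht
    have ht' := ht.trans (Nat.left_le_pair t n)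
    simp only [max_le_iff] at ht'
    rw [C.apply, zeroApprox_eq_one_iff]
    refine hkm.mono ?_ ht'.2
    refine ((prefixOf_isPrefix r hM).trans ?_).trans (List.prefix_append _ _)
    rw [hr M]
    exact C.prefix_of_le ht'.1
  · obtain ⟨M, hM⟩ := C.exists_le_length hinf (n + 1)
    filter_upwards [eventually_ge_atTop M] with t ht
    rw [C.apply, zeroApprox_eq_zero_iff]
    intro hst
    -- Up to the first extension after the claim the word is unchanged, so the claim is still in
    -- force when `Ready` is tested.
    have hex : ∃ m, Nat.pair t n ≤ m ∧ σ (m + 1) ≠ σ m := hinf _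
    classical
    obtain ⟨hm, hne⟩ := Nat.find_spec hex
    have hconst : ∀ m, Nat.pair t n ≤ m → m ≤ Nat.find hex → σ m = σ (Nat.pair t n) := by
      intro m hle
      induction m, hle using Nat.le_induction with
      | base => intro _; rfl
      | succ m hle ih =>
        intro hlt
        rw [← ih (by omega)]
        by_contra hcon
        exact Nat.find_min hex hlt ⟨hle, hcon⟩
    have hσ := hconst _ hm le_rfl
    obtain ⟨hready, b, -, hb⟩ := C.step_of_ne hne
    have hlen : n < (σ (Nat.find hex)).length :=
      hM.trans (C.prefix_of_le ((ht.trans (Nat.left_le_pair t n)).trans hm)).length_le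
    have hst' : StageMem (padTo (σ (Nat.find hex)) (stagePos (Nat.find hex))) (Nat.find hex) n := by
      refine (hready.2 n hlen).resolve_left (not_not.2 (hst.mono ?_ hm))
      rw [hσ]
      refine (List.prefix_append_right_inj _).2 ?_
      rw [List.prefix_replicate_iff]
      simp
      omega
    refine hn (mem_ceOpen_iff_stageMem.2 ⟨stagePos (Nat.find hex) + 1, _, hst'.mono ?_ le_rfl⟩)
    have hrm := hr (Nat.find hex + 1)
    rw [hb, List.length_append, length_padTo hready.1.1, List.length_singleton] at hrm
    rw [hrm]
    exact List.prefix_append _ _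

variable {p q : Baire}

theorem false_of_finite (C : IsConstruction g h σ x)
    (hr : ∀ m, prefixOf r (σ m).length = σ m) {M : ℕ} (hfin : ∀ m ≥ M, σ m = σ M)
    (h0 : ∀ j, (σ M).length ≤ j → r j = 0) (hg : Produces g x p) (hh : Produces h q r)
    (hlim : Tendsto (component p) atTop (𝓝 q)) : False := by
  obtain ⟨B, hB⟩ : ∃ B, ∀ n < (σ M).length, r ∈ ceOpen n → StageMem (prefixOf r B) B n := by
    have hex : ∀ n, ∃ B, r ∈ ceOpen n → StageMem (prefixOf r B) B n := by
      intro n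
      by_cases hn : r ∈ ceOpen n
      · obtain ⟨k, m, hkm⟩ := mem_ceOpen_iff_stageMem.1 hn
        exact ⟨max k m, fun _ => hkm.mono (prefixOf_isPrefix r (le_max_left _ _))
          (le_max_right _ _)⟩
      · exact ⟨0, fun h => absurd h hn⟩
    choose B hB using hex
    refine ⟨(Finset.range (σ M).length).sup B, fun n hn hrn => ?_⟩
    have hle : B n ≤ (Finset.range (σ M).length).sup B :=
      Finset.le_sup (f := B) (Finset.mem_range.2 hn)
    exact (hB n hrn).mono (prefixOf_isPrefix r hle) hle
  obtain ⟨k, hk⟩ := hh.complete (max (σ M).length B)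
  obtain ⟨i, hiL, hi⟩ := ((eventually_ge_atTop (σ M).length).and
    (eventually_prefixOf_eq hlim k)).exists
  obtain ⟨l, hl⟩ := hg.eventually_length (Nat.pair i k)
  let m := Nat.pair (Nat.pair (max (σ M).length B) i) (Nat.pair k (max M (max B l)))
  have hm : max M (max B l) ≤ m := (Nat.right_le_pair _ _).trans (Nat.right_le_pair _ _)
  simp only [max_le_iff] at hm
  have hs : stagePos m = max (σ M).length B := by simp [stagePos, m]
  have hi' : stageRow m = i := by simp [stageRow, m]
  have hk' : stageLen m = k := by simp [stageLen, m]
  have hlen := (hl m hm.2.2).le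
  have hready : Ready (g (prefixOf x m)) (σ m) m := by
    refine ⟨?_, fun n hn => or_iff_not_imp_left.2 fun hst => ?_⟩
    · rw [hs, hi', hk', hfin m hm.1]
      exact ⟨le_max_left _ _, hiL, hlen⟩
    · rw [hfin m hm.1] at hn hst ⊢
      rw [padTo_prefixOf (hr M) h0 (Nat.le_add_right _ _), not_not] at hst
      rw [hs, padTo_prefixOf (hr M) h0 (le_max_left _ _)]
      exact (hB n hn (mem_ceOpen_iff_stageMem.2 ⟨_, _, hst⟩)).mono
        (prefixOf_isPrefix r (le_max_right _ _)) hm.2.1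
  have hsucc := C.succ m
  rw [nextWord_of_ready (b := r (max (σ M).length B)) hready (by
    rw [hs, hi', hk', hg.rowPrefix_eq hlen, hi, hk k le_rfl]), hs, hfin m hm.1,
    hfin (m + 1) (by omega)] at hsucc
  have := congrArg List.length hsucc
  rw [List.length_append, length_padTo (le_max_left _ _), List.length_singleton] at this
  omega

theorem false_of_infinite (C : IsConstruction g h σ x) (hhc : Computable h)
    (hr : ∀ m, prefixOf r (σ m).length = σ m) (hinf : ∀ M, ∃ m ≥ M, σ (m + 1) ≠ σ m)
    (hg : Produces g x p) (hh : Produces h q r) (hlim : q ∈ limJ p) : False := by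
  let f : List ℕ × ℕ →. Unit := fun a => (((h a.1)[a.2.unpair.2]?.bind fun b =>
    if (σ a.2.unpair.1)[a.2.unpair.2]? = some (b + 1) then some () else none : Option Unit))
  have hf : Partrec f := by
    have hu : Computable fun a : List ℕ × ℕ => a.2.unpair := Computable.unpair.comp Computable.snd
    have hu2 := Computable.snd.comp hu
    have hif : Primrec₂ fun (o : Option ℕ) (b : ℕ) =>
        if o = some (b + 1) then some () else none :=
      Primrec.ite (Primrec.eq.comp Primrec.fst (Primrec.option_some.comp
        (Primrec.succ.comp Primrec.snd))) (Primrec.const _) (Primrec.const _)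
    refine Computable.ofOption (Computable.option_bind
      (Computable.list_getElem?.comp (hhc.comp Computable.fst) hu2) ?_)
    exact hif.to_comp.comp ((Computable.list_getElem?.comp
      (C.computable.comp (Computable.fst.comp hu)) hu2).comp Computable.fst) Computable.snd
  have hdom : ∀ w : List ℕ, (∃ u, (f (w, u)).Dom) ↔
      ∃ m j b : ℕ, (h w)[j]? = some b ∧ (σ m)[j]? = some (b + 1) := by
    intro w
    constructor
    · rintro ⟨u, hu⟩
      obtain ⟨_, hz⟩ := Part.dom_iff_mem.1 hu
      obtain ⟨b, hb, hif⟩ := Option.bind_eq_some_iff.1 (Part.mem_ofOption.1 hz)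
      split_ifs at hif with hc
      exact ⟨_, _, b, hb, hc⟩
    · rintro ⟨m, j, b, hb, hc⟩
      refine ⟨Nat.pair m j, Part.dom_iff_mem.2 ⟨(), Part.mem_ofOption.2 ?_⟩⟩
      simp [hb, hc]
  obtain ⟨n, hn⟩ := exists_ceOpen (rePred_exists_dom hf)
  simp only [hdom] at hn
  have hqn : q ∉ ceOpen n := by
    rw [hn]
    rintro ⟨k, m, j, b, hb, hc⟩
    have hj : j < (σ m).length := (List.getElem?_eq_some_iff.1 hc).1
    rw [← hr m, getElem?_prefixOf r hj, ← hh.sound k j b hb] at hc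
    exact absurd (Option.some_injective _ hc) (by omega)
  obtain ⟨N, hN⟩ := eventually_atTop.1 (tendsto_jump.1 (mem_limJ.1 hlim) n)
  obtain ⟨M, hM⟩ := C.exists_le_length hinf N
  obtain ⟨m, hm, hne⟩ := hinf M
  obtain ⟨hready, b, hb, hσ⟩ := C.step_of_ne hne
  have hi : N ≤ stageRow m := (hM.trans (C.prefix_of_le hm).length_le).trans hready.1.2.1
  refine hqn ((hN _ hi).1 ((hn _).2 ⟨stageLen m, m + 1, stagePos m, b, ?_, ?_⟩))
  · rw [← hg.rowPrefix_eq hready.1.2.2]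
    exact hb
  · have hlen := length_padTo hready.1.1
    rw [hσ, List.getElem?_append_right hlen.le, hlen]
    simp

end IsConstruction

theorem not_low_swReducible_limJ : ¬ SWReducible low limJ := by
  rintro ⟨K, H, hK, hH, hred⟩
  obtain ⟨G, hG, hGmem⟩ := exists_realizer limJ
  obtain ⟨g, hgc, -, hg⟩ := exists_produces hH
  obtain ⟨h, hhc, -, hh⟩ := exists_produces hK
  obtain ⟨σ, x, C⟩ := exists_isConstruction hgc hhc
  obtain ⟨r, hr, h0⟩ := exists_limit_of_chain fun m n hmn => C.prefix_of_le (m := m) hmn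
  have key : jump r ∈ limMap x → ∃ p q, Produces g x p ∧ q ∈ limJ p ∧ Produces h q r := by
    intro hx
    obtain ⟨s, hs, y, hy, hyl⟩ := hred G hG x x (Part.mem_some _) ⟨r, hx⟩
    obtain rfl := Part.mem_some_iff.1 hy
    have hyr : y = r := jump_injective (tendsto_nhds_unique hyl hx)
    simp only [Part.mem_bind_iff] at hs
    obtain ⟨p, hp, q, hq, hs⟩ := hs
    exact ⟨p, q, hg _ _ hp, hGmem _ _ hq, hyr ▸ hh _ _ hs⟩
  by_cases hinf : ∀ M, ∃ m ≥ M, σ (m + 1) ≠ σ m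
  · obtain ⟨p, q, hp, hq, hq'⟩ := key (C.jump_mem_limMap_of_infinite hr hinf)
    exact C.false_of_infinite hhc hr hinf hp hq' hq
  · push Not at hinf
    obtain ⟨M, hM⟩ := hinf
    have hfin : ∀ m ≥ M, σ m = σ M := by
      intro m hm
      induction m, hm using Nat.le_induction with
      | base => rfl
      | succ m hm ih => rw [hM m hm, ih]
    have h0' : ∀ j, (σ M).length ≤ j → r j = 0 := by
      refine fun j hj => h0 j fun m => le_trans ?_ hj
      rcases le_total m M with hm | hm
      · exact (C.prefix_of_le hm).length_le
      · rw [hfin m hm]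
    obtain ⟨p, q, hp, hq, hq'⟩ := key (C.jump_mem_limMap_of_finite hr hfin h0')
    exact C.false_of_finite hr hfin h0' hp hq' (tendsto_of_tendsto_jump (mem_limJ.1 hq))

end Weihrauch

theorem mainTheorem11 :
    Weihrauch.StrictSWReducible Weihrauch.limJ Weihrauch.low ∧
    ¬ Weihrauch.WReducible (Weihrauch.closedChoice Weihrauch.Cantor) Weihrauch.limJ ∧
    ∀ f p : ℕ → ℕ, Weihrauch.DiagonallyNonComputable f → Weihrauch.LimitComputableInJump p →
      ¬ TuringReducible (f : ℕ →. ℕ) (p : ℕ →. ℕ) :=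
  ⟨⟨Weihrauch.limJ_swReducible_low, Weihrauch.not_low_swReducible_limJ⟩,
    Weihrauch.not_closedChoice_wReducible_limJ, fun _ _ hf hp => hf.not_turingReducible hp⟩
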